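/- Let $p\ge 1$ be an integer, $a_1,\dots,a_p\in\mathbb{R}$ and $\lambda>0$, and write $(x)_+=\max(0,x)$. Let $P$ be the transition kernel on $\mathbb{N}^p$ that moves from $x=(x_1,\dots,x_p)$ to $(\ell,x_1,\dots,x_{p-1})$, where $\ell$ is Poisson distributed with parameter $(a_1x_1+\cdots+a_px_p+\lambda)_+$ (the Poisson law with parameter $0$ being the Dirac mass at $0$). A discrete-time Hawkes process with memory $p$ is a sequence $(\tilde X_n)_{n\ge 1-p}$ of $\mathbb{N}$-valued random variables such that, for every $n\ge 1$, conditionally on $\tilde X_{1-p},\dots,\tilde X_{n-1}$, the variable $\tilde X_n$ is Poisson distributed with parameter $(a_1\tilde X_{n-1}+\cdots+a_p\tilde X_{n-p}+\lambda)_+$. Suppose that $$(a_1)_++\cdots+(a_p)_+<1 .$$ Then, for every such process, $X_n:=(\tilde X_n,\tilde X_{n-1},\dots,\tilde X_{n-p+1})$, $n\ge 0$, is a Markov chain on $\mathbb{N}^p$ with transition kernel $P$, and this chain is geometrically ergodic: there exist a probability measure $\pi$ on $\mathbb{N}^p$ with $\pi P=\pi$ and a number $\rho\in(0,1)$ such that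 for every initial state $x\in\mathbb{N}^p$ there is a constant $C_x<\infty$ with $$\sup_{A\subseteq\mathbb{N}^p}\bigl|P^n(x,A)-\pi(A)\bigr|\le C_x\,\rho^n\qquad\text{for all } n\ge 0 .$$ -/

import Mathlib

open MeasureTheory ProbabilityTheory
open scoped NNReal ENNReal

noncomputable section

/-- The intensity `s_x = (a₁ x₁ + ⋯ + a_p x_p + lam)₊`, a nonnegative real. Coordinates are indexed
by `Fin p`, so that `a i` and `x i` stand for `a_{i+1}` and `x_{i+1}`. -/
def hawkesIntensity {p : ℕ} (a : Fin p → ℝ) (lam : ℝ) (x : Fin p → ℕ) : ℝ≥0 :=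
  Real.toNNReal ((∑ i, a i * (x i : ℝ)) + lam)

/-- The shifted state `(ℓ, x₁, …, x_{p-1})`: put `ℓ` in front of `x` and drop the last entry. -/
def hawkesShift {p : ℕ} (x : Fin p → ℕ) (l : ℕ) : Fin p → ℕ :=
  fun i => (Fin.cons l x : Fin (p + 1) → ℕ) i.castSucc

/-- The transition kernel on `ℕ^p`: from `x`, jump to `(ℓ, x₁, …, x_{p-1})` where `ℓ` is Poisson
distributed with parameter `s_x` (the Poisson law with parameter `0` is the Dirac mass at `0`). -/
def hawkesKernel {p : ℕ} (a : Fin p → ℝ) (lam : ℝ) : Kernel (Fin p → ℕ) (Fin p → ℕ) where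
  toFun x := (poissonMeasure (hawkesIntensity a lam x)).map (hawkesShift x)
  measurable' := .of_discrete

/-- `Xt` (only the indices `k ≥ 1 - p` matter) is a discrete-time Hawkes process with memory `p`:
for every `n ≥ 0`, conditionally on the whole past `Xt (1 - p), …, Xt n`, the variable
`Xt (n + 1)` is Poisson distributed with parameter `(a₁ Xt n + ⋯ + a_p Xt (n - p + 1) + lam)₊`.
The values being integers, this is expressed through the probabilities of all possible histories
`w`. The law of the initial condition `(Xt 0, …, Xt (1 - p))` is arbitrary. -/
structure IsHawkesProcess {Ω : Type*} [MeasurableSpace Ω] {p : ℕ} (a : Fin p → ℝ) (lam : ℝ)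
    (μ : Measure Ω) (Xt : ℤ → Ω → ℕ) : Prop where
  measurable : ∀ k, Measurable (Xt k)
  cond_poisson : ∀ (n : ℕ) (w : ℤ → ℕ),
    μ {ω | ∀ k : ℤ, 1 - (p : ℤ) ≤ k → k ≤ (n : ℤ) + 1 → Xt k ω = w k} =
      μ {ω | ∀ k : ℤ, 1 - (p : ℤ) ≤ k → k ≤ (n : ℤ) → Xt k ω = w k} *
        poissonMeasure (hawkesIntensity a lam fun i : Fin p => w ((n : ℤ) - (i : ℤ)))
          {w ((n : ℤ) + 1)}

/-- The memory vector `X_n = (Xt n, Xt (n - 1), …, Xt (n - p + 1))`. -/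
def memoryVector {Ω : Type*} (p : ℕ) (Xt : ℤ → Ω → ℕ) (n : ℕ) (ω : Ω) : Fin p → ℕ :=
  fun i => Xt ((n : ℤ) - (i : ℤ)) ω

/-- `X` is a (time-homogeneous) Markov chain with transition kernel `P` on the countable discrete
state space `S`: given the whole past `X 0, …, X n`, the next state has law `P (X n)`. -/
structure IsMarkovChain {Ω S : Type*} [MeasurableSpace Ω] [MeasurableSpace S] [Countable S]
    [DiscreteMeasurableSpace S] (P : Kernel S S) (μ : Measure Ω) (X : ℕ → Ω → S) : Prop where
  measurable : ∀ n, Measurable (X n)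
  markov : ∀ (n : ℕ) (y : ℕ → S),
    μ {ω | ∀ k ≤ n + 1, X k ω = y k} = μ {ω | ∀ k ≤ n, X k ω = y k} * P (y n) {y (n + 1)}

/-- The total variation distance between two probability measures,
`sup_A |μ(A) - ν(A)|` over measurable sets `A`. -/
def tvDist {S : Type*} [MeasurableSpace S] (μ ν : Measure S) : ℝ :=
  ⨆ A : {A : Set S // MeasurableSet A}, |μ.real A - ν.real A|

/-- Geometric ergodicity of the Markov chain with transition kernel `P`: there is a stationary
distribution `π`, and a rate `ρ ∈ (0, 1)`, such that from every initial state `x` the law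
`P ^ n x` of the chain at time `n` converges to `π` in total variation at speed `ρ ^ n`, with a
multiplicative constant that may depend on `x`. -/
def IsGeometricallyErgodic {S : Type*} [MeasurableSpace S] (P : Kernel S S) : Prop :=
  ∃ π : Measure S, IsProbabilityMeasure π ∧ Kernel.Invariant P π ∧
    ∃ ρ : ℝ, 0 < ρ ∧ ρ < 1 ∧
      ∀ x : S, ∃ C : ℝ, ∀ n : ℕ, tvDist ((P ^ n) x) π ≤ C * ρ ^ n

end

/-!
The Markov property is a matter of bookkeeping. A path of memory vectors is determined by the scalar
history it contains, so the event `X 0 = y 0, …, X n = y n` is either empty or a history event of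
the Hawkes process (`setOf_memoryVector_eq`, `setOf_memoryVector_eq_empty`), and the defining
property of the process applies (`IsHawkesProcess.isMarkovChain_memoryVector`).

Geometric ergodicity follows from a drift condition and an atom, as in the proof of Harris' theorem
by Hairer and Mattingly. Only the positive parts of the `a i` enter.

* Drift: since `∑ (a i)₊ < 1`, there are weights `w` for which `V x = ∑ w i * x i` satisfies
  `P V ≤ γ V + K` with `γ < 1` (`exists_weights`, `lintegral_weight_hawkesKernel_le`).
* Atom: drawing `0` at `p` successive times brings the chain to the state `0`. Along that path `V`
  does not increase and the intensity is at most `V + lam`, so this has probability bounded below on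
  every sublevel set of `V` (`exp_neg_mul_le_hawkesKernel_pow`).
* Contraction: two independent copies of the `p`-step chain either start where `V` is large, and the
  drift brings them closer, or start where `V` is bounded, and meet at `0` with probability bounded
  below. Hence the `p`-step kernel contracts oscillations measured against `1 + β (V x + V y)`
  (`exists_contraction_of_drift_of_atom`), and
  `|P ^ n (x, A) - P ^ n (y, A)| ≤ c ρ ^ n (1 + β (V x + V y))` uniformly in `A`.
* Limit: integrating this bound over the first step of the chain shows that `n ↦ P ^ n (x, A)` is
  Cauchy at a geometric rate, uniformly in `A`. The uniformity makes the limit a probability measure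
  (`exists_isProbabilityMeasure_of_uniform_setwise_limit`), and it is stationary
  (`invariant_of_tendsto_pow`).
-/

open Filter Topology


/-! ### Powers of a Markov kernel -/

section MarkovKernel

variable {S : Type*} [MeasurableSpace S]

theorem isMarkovKernel_pow (P : Kernel S S) [IsMarkovKernel P] (n : ℕ) :
    IsMarkovKernel (P ^ n) := by
  induction n with
  | zero => exact inferInstanceAs (IsMarkovKernel (Kernel.id : Kernel S S))
  | succ n ih => rw [Kernel.pow_add]; rw [pow_one]; infer_instance

theorem real_pow_add_apply (P : Kernel S S) [IsMarkovKernel P] (m n : ℕ) (x : S) {A : Set S}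
    (hA : MeasurableSet A) :
    ((P ^ (m + n)) x).real A = ∫ y, ((P ^ n) y).real A ∂((P ^ m) x) := by
  have := isMarkovKernel_pow P n
  simp only [Measure.real]
  rw [Kernel.pow_add_apply_eq_lintegral P m n x hA, integral_toReal]
  · exact (Kernel.measurable_coe _ hA).aemeasurable
  · exact .of_forall fun y => measure_lt_top _ _

/-- The drift condition passes to the powers of `P`. The additive constant `n * K` is crude, but only
one fixed power is ever used. -/
theorem lintegral_pow_le_of_drift [DiscreteMeasurableSpace S] (P : Kernel S S)
    [IsMarkovKernel P] (V : S → ℝ≥0) {γ K : ℝ≥0} (hγ : γ ≤ 1)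
    (hdrift : ∀ x, ∫⁻ y, V y ∂(P x) ≤ γ * V x + K) (n : ℕ) (x : S) :
    ∫⁻ y, V y ∂((P ^ n) x) ≤ γ ^ n * V x + n * K := by
  have hm : ∀ f : S → ℝ≥0∞, Measurable f := fun f => .of_discrete
  induction n with
  | zero =>
    rw [pow_zero]
    change ∫⁻ y, V y ∂((Kernel.id : Kernel S S) x) ≤ _
    rw [Kernel.id_apply, lintegral_dirac' _ (hm _)]
    simp
  | succ n ih =>
    have := isMarkovKernel_pow P n
    rw [add_comm n 1, Kernel.pow_add, pow_one, Kernel.lintegral_comp _ _ _ (hm _)]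
    calc ∫⁻ y, ∫⁻ z, V z ∂(P y) ∂((P ^ n) x)
        ≤ ∫⁻ y, (γ * V y + K) ∂((P ^ n) x) := lintegral_mono fun y => hdrift y
      _ = γ * ∫⁻ y, V y ∂((P ^ n) x) + K := by
          rw [lintegral_add_left (hm _), lintegral_const_mul _ (hm _)]
          simp
      _ ≤ γ * (γ ^ n * V x + n * K) + K := by gcongr
      _ = γ ^ (1 + n) * V x + (γ * (n * K) + K) := by ring
      _ ≤ γ ^ (1 + n) * V x + (1 * (n * K) + K) := by
          gcongr; exact_mod_cast hγ
      _ = _ := by push_cast; ring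

end MarkovKernel

/-! ### Contraction from a drift condition and an atom -/

section Harris

variable {S : Type*} [MeasurableSpace S] [DiscreteMeasurableSpace S]

theorem integrable_and_integral_le_of_lintegral_le {μ : Measure S} {V : S → ℝ≥0} {c : ℝ≥0}
    (h : ∫⁻ y, V y ∂μ ≤ c) :
    Integrable (fun y => (V y : ℝ)) μ ∧ ∫ y, (V y : ℝ) ∂μ ≤ c := by
  have hm : Measurable V := .of_discrete
  refine ⟨⟨hm.coe_nnreal_real.aestronglyMeasurable, ?_⟩, ?_⟩
  · simpa [HasFiniteIntegral] using h.trans_lt ENNReal.coe_lt_top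
  · have : ∫ y, (V y : ℝ) ∂μ = (∫⁻ y, V y ∂μ).toReal := by
      rw [← integral_toReal hm.coe_nnreal_ennreal.aemeasurable
        (.of_forall fun y => ENNReal.coe_lt_top)]
      rfl
    rw [this]
    exact ENNReal.toReal_le_coe_of_le_coe h

/-- Comparison of integrals under the product coupling of `μ` and `ν`: an oscillation bound on `f` with
weight `1 + β (V u + V v)` integrates, and the event that both coordinates sit at `z`, where
`f u - f v` vanishes, is gained from the constant term. -/
theorem integral_sub_integral_le_of_atom {μ ν : Measure S} [IsProbabilityMeasure μ]
    [IsProbabilityMeasure ν] {V f : S → ℝ} {M β : ℝ} (z : S) (hM : 0 ≤ M) (hβ : 0 ≤ β)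
    (hV : 0 ≤ V z) (hfμ : Integrable f μ) (hfν : Integrable f ν) (hVμ : Integrable V μ)
    (hVν : Integrable V ν) (hf : ∀ u v, |f u - f v| ≤ M * (1 + β * (V u + V v))) :
    |∫ u, f u ∂μ - ∫ v, f v ∂ν| ≤
      M * (1 - μ.real {z} * ν.real {z} + β * (∫ u, V u ∂μ + ∫ v, V v ∂ν)) := by
  have hz : MeasurableSet ({z} ×ˢ {z} : Set (S × S)) := .prod .of_discrete .of_discrete
  have h1 : ∫ u, f u ∂μ - ∫ v, f v ∂ν = ∫ w, (f w.1 - f w.2) ∂(μ.prod ν) := by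
    rw [integral_sub (hfμ.comp_fst ν) (hfν.comp_snd μ), integral_fun_fst, integral_fun_snd]
    simp
  have hi : Integrable (({z} ×ˢ {z} : Set (S × S)).indicator fun _ => (1 : ℝ)) (μ.prod ν) :=
    (integrable_const _).indicator hz
  have hVi : Integrable (fun w : S × S => V w.1 + V w.2) (μ.prod ν) :=
    (hVμ.comp_fst ν).add (hVν.comp_snd μ)
  have h1i : Integrable (fun w => 1 - ({z} ×ˢ {z} : Set (S × S)).indicator (fun _ => (1 : ℝ)) w)
      (μ.prod ν) := (integrable_const _).sub hi
  have hs : Integrable (fun w => M * (1 - ({z} ×ˢ {z} : Set (S × S)).indicator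
      (fun _ => (1 : ℝ)) w + β * (V w.1 + V w.2))) (μ.prod ν) :=
    (h1i.add (hVi.const_mul β)).const_mul M
  have h2 : ∫ w, M * (1 - ({z} ×ˢ {z} : Set (S × S)).indicator (fun _ => (1 : ℝ)) w
      + β * (V w.1 + V w.2)) ∂(μ.prod ν) =
      M * (1 - μ.real {z} * ν.real {z} + β * (∫ u, V u ∂μ + ∫ v, V v ∂ν)) := by
    rw [integral_const_mul, integral_add h1i (hVi.const_mul β), integral_const_mul,
      integral_add (hVμ.comp_fst ν) (hVν.comp_snd μ), integral_fun_fst, integral_fun_snd,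
      integral_sub (integrable_const _) hi, integral_indicator_const _ hz, measureReal_prod_prod]
    simp
  rw [h1, ← h2, ← Real.norm_eq_abs]
  refine norm_integral_le_of_norm_le hs (.of_forall fun w => ?_)
  rw [Real.norm_eq_abs]
  by_cases hw : w ∈ ({z} ×ˢ {z} : Set (S × S))
  · rw [Set.indicator_of_mem hw]
    obtain ⟨h₁, h₂⟩ := hw
    rw [Set.mem_singleton_iff.1 h₁, Set.mem_singleton_iff.1 h₂]
    simp only [sub_self, abs_zero, zero_add]
    positivity
  · rw [Set.indicator_of_notMem hw, sub_zero]
    exact hf _ _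

/-- The Hairer–Mattingly contraction: a drift condition, together with a lower bound on the mass that
`Q x` gives to a point `z` on each sublevel set of `V`, makes `Q` a strict contraction for the
oscillation seminorm with weight `1 + β (V x + V y)`. -/
theorem exists_contraction_of_drift_of_atom (Q : Kernel S S) [IsMarkovKernel Q] (V : S → ℝ≥0)
    {γ K : ℝ≥0} (hγ : γ < 1) (hdrift : ∀ x, ∫⁻ y, V y ∂(Q x) ≤ γ * V x + K) (z : S)
    (hmin : ∀ R : ℝ, ∃ ε : ℝ, 0 < ε ∧ ∀ x, V x ≤ R → ε ≤ (Q x).real {z}) :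
    ∃ β α : ℝ, 0 ≤ β ∧ 0 < α ∧ α < 1 ∧ ∀ (f : S → ℝ) (M : ℝ), 0 ≤ M →
      (∀ x, Integrable f (Q x)) → (∀ u v, |f u - f v| ≤ M * (1 + β * (V u + V v))) →
      ∀ x y, |∫ u, f u ∂(Q x) - ∫ v, f v ∂(Q y)| ≤ (α * M) * (1 + β * (V x + V y)) := by
  have hγ' : (γ : ℝ) < 1 := by exact_mod_cast hγ
  have hγ0 : 0 ≤ (γ : ℝ) := γ.2
  have hK0 : 0 ≤ (K : ℝ) := K.2
  -- Where `V x + V y` exceeds this threshold, the drift alone contracts.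
  obtain ⟨ε, hε, hmin⟩ := hmin ((4 * K + 2) / (1 - γ))
  -- `β` is so small that the additive constant `K` of the drift eats at most half of the gain
  -- `ε ^ 2` due to both chains meeting at `z`.
  obtain ⟨β, hβ⟩ : ∃ β : ℝ, β = ε ^ 2 / (4 * (K + 1)) := ⟨_, rfl⟩
  have hβ0 : 0 < β := by rw [hβ]; positivity
  have hβK : 2 * β * K ≤ ε ^ 2 / 2 := by
    rw [hβ, mul_div_assoc', div_mul_eq_mul_div, div_le_div_iff₀ (by positivity) (by norm_num)]
    nlinarith [sq_nonneg ε]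
  refine ⟨β, max ((1 + γ) / 2) (max (1 - ε ^ 2 / 2) (1 - β)), hβ0.le,
    lt_max_of_lt_left (by linarith), max_lt (by linarith)
      (max_lt (by linarith [pow_pos hε 2]) (by linarith)), fun f M hM hfi hf x y => ?_⟩
  set α := max (((1 : ℝ) + γ) / 2) (max (1 - ε ^ 2 / 2) (1 - β)) with hα
  have hα1 : (1 + (γ : ℝ)) / 2 ≤ α := le_max_left _ _
  have hα2 : 1 - ε ^ 2 / 2 ≤ α := (le_max_left _ _).trans (le_max_right _ _)
  have hα3 : 1 - β ≤ α := (le_max_right _ _).trans (le_max_right _ _)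
  obtain ⟨hix, hVx⟩ := integrable_and_integral_le_of_lintegral_le (c := γ * V x + K)
    (by exact_mod_cast hdrift x)
  obtain ⟨hiy, hVy⟩ := integrable_and_integral_le_of_lintegral_le (c := γ * V y + K)
    (by exact_mod_cast hdrift y)
  push_cast at hVx hVy
  refine (integral_sub_integral_le_of_atom z hM hβ0.le (V z).2 (hfi x) (hfi y) hix hiy hf).trans ?_
  rw [mul_comm α M, mul_assoc]
  refine mul_le_mul_of_nonneg_left ?_ hM
  have hx0 : 0 ≤ (V x : ℝ) := (V x).2
  have hy0 : 0 ≤ (V y : ℝ) := (V y).2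
  have hb : β * (∫ u, (V u : ℝ) ∂(Q x) + ∫ v, (V v : ℝ) ∂(Q y)) ≤
      β * (γ * (V x + V y) + 2 * K) := by
    refine mul_le_mul_of_nonneg_left ?_ hβ0.le
    linarith
  have hW : 0 ≤ β * ((V x : ℝ) + V y) := by positivity
  have hαW := mul_le_mul_of_nonneg_right hα1 hW
  rcases lt_or_ge ((V x : ℝ) + V y) ((4 * K + 2) / (1 - γ)) with h | h
  · have h1 : ε ^ 2 ≤ (Q x).real {z} * (Q y).real {z} := by
      rw [sq]
      exact mul_le_mul (hmin x (by linarith)) (hmin y (by linarith)) hε.le (by positivity)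
    nlinarith [mul_nonneg hW (sub_nonneg.2 hγ'.le)]
  · rw [div_le_iff₀ (by linarith)] at h
    have h2 : 0 ≤ (Q x).real {z} * (Q y).real {z} := by positivity
    nlinarith [mul_le_mul_of_nonneg_left h hβ0.le]

end Harris

/-! ### Uniform setwise limits of probability measures -/

section SetwiseLimit

variable {S : Type*} [MeasurableSpace S]

/-- A limit of probability measures that is uniform over measurable sets is a probability measure:
uniformity allows the limit to be exchanged with countable sums. -/
theorem exists_isProbabilityMeasure_of_uniform_setwise_limit (μ : ℕ → Measure S)
    [∀ n, IsProbabilityMeasure (μ n)] (l : Set S → ℝ) (b : ℕ → ℝ) (hb : Tendsto b atTop (𝓝 0))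
    (h : ∀ n A, MeasurableSet A → |(μ n).real A - l A| ≤ b n) :
    ∃ π : Measure S, IsProbabilityMeasure π ∧ ∀ A, MeasurableSet A → π.real A = l A := by
  have hlim : ∀ A, MeasurableSet A → Tendsto (fun n => (μ n).real A) atTop (𝓝 (l A)) :=
    fun A hA => tendsto_iff_dist_tendsto_zero.2
      (squeeze_zero (fun _ => dist_nonneg) (fun n => h n A hA) hb)
  have h0 : ∀ A, MeasurableSet A → 0 ≤ l A := fun A hA =>
    ge_of_tendsto' (hlim A hA) fun n => measureReal_nonneg
  have hempty : l ∅ = 0 :=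
    tendsto_nhds_unique (hlim ∅ .empty) (by simp)
  have huniv : l Set.univ = 1 :=
    tendsto_nhds_unique (hlim _ .univ) (by simp)
  have hsum : ∀ f : ℕ → Set S, (∀ i, MeasurableSet (f i)) → Pairwise (Function.onFun Disjoint f) →
      HasSum (fun i => l (f i)) (l (⋃ i, f i)) := by
    intro f hf hd
    have hfin : ∀ n k, (μ n).real (⋃ i ∈ Finset.range k, f i) =
        ∑ i ∈ Finset.range k, (μ n).real (f i) := fun n k =>
      measureReal_biUnion_finset (fun i _ j _ hij => hd hij) fun i _ => hf i
    have hlfin : ∀ k, l (⋃ i ∈ Finset.range k, f i) = ∑ i ∈ Finset.range k, l (f i) := fun k =>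
      tendsto_nhds_unique (hlim _ (Finset.measurableSet_biUnion _ fun i _ => hf i))
        (by simp_rw [hfin]; exact tendsto_finsetSum _ fun i _ => hlim _ (hf i))
    rw [hasSum_iff_tendsto_nat_of_nonneg fun i => h0 _ (hf i)]
    have hunif : TendstoUniformly (fun n k => ∑ i ∈ Finset.range k, (μ n).real (f i))
        (fun k => ∑ i ∈ Finset.range k, l (f i)) atTop := by
      rw [Metric.tendstoUniformly_iff]
      intro ε hε
      filter_upwards [hb.eventually_lt_const hε] with n hn k
      rw [← hfin, ← hlfin, dist_comm]
      exact (h n _ (Finset.measurableSet_biUnion _ fun i _ => hf i)).trans_lt hn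
    refine hunif.tendsto_of_eventually_tendsto (.of_forall fun n => ?_)
      (hlim _ (MeasurableSet.iUnion hf))
    have hU : ∑' i, μ n (f i) ≠ ∞ := by
      rw [← measure_iUnion hd hf]; exact measure_ne_top _ _
    have hsum := (ENNReal.hasSum_toReal hU).tendsto_sum_nat
    rwa [← ENNReal.tsum_toReal_eq fun i => measure_ne_top _ _, ← measure_iUnion hd hf] at hsum
  let π : Measure S := Measure.ofMeasurable (fun A _ => ENNReal.ofReal (l A)) (by simp [hempty])
    fun f hf hd => by
      have hs := hsum f hf hd
      rw [← hs.tsum_eq, ENNReal.ofReal_tsum_of_nonneg (fun i => h0 _ (hf i)) hs.summable]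
  have hπ : ∀ A, MeasurableSet A → π A = ENNReal.ofReal (l A) := fun A hA =>
    Measure.ofMeasurable_apply A hA
  exact ⟨π, ⟨by simp [hπ, huniv]⟩, fun A hA => by
    rw [Measure.real, hπ A hA, ENNReal.toReal_ofReal (h0 A hA)]⟩

/-- A setwise limit of the laws of the chain is stationary. By Fatou's lemma (in the form used for the
portmanteau theorem, with the discrete topology) `π P ≤ π`, and both are probability measures. -/
theorem invariant_of_tendsto_pow [DiscreteMeasurableSpace S] (P : Kernel S S) [IsMarkovKernel P]
    (π : Measure S) [IsProbabilityMeasure π] (x : S)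
    (h : ∀ A : Set S, Tendsto (fun n => ((P ^ n) x).real A) atTop (𝓝 (π.real A))) :
    Kernel.Invariant P π := by
  have hm : ∀ n, IsMarkovKernel (P ^ n) := isMarkovKernel_pow P
  have h' : ∀ A : Set S, Tendsto (fun n => (P ^ n) x A) atTop (𝓝 (π A)) := fun A => by
    have := ENNReal.tendsto_ofReal (h A)
    simpa [ofReal_measureReal] using this
  let _ : TopologicalSpace S := ⊥
  have : DiscreteTopology S := ⟨rfl⟩
  have : OpensMeasurableSpace S := ⟨fun _ _ => .of_discrete⟩
  have hle : ∀ A, MeasurableSet A → (π.bind P) A ≤ π A := by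
    intro A hA
    rw [Measure.bind_apply hA P.aemeasurable]
    have hF := lintegral_le_liminf_lintegral_of_forall_isOpen_measure_le_liminf_measure
      (μ := π) (μs := fun n => (P ^ n) x) (f := fun y => (P y).real A)
      continuous_of_discreteTopology (fun y => measureReal_nonneg)
      fun G _ => (h' G).liminf_eq.ge
    have hreal : ∀ y, ENNReal.ofReal ((P y).real A) = P y A := fun y => ofReal_measureReal
    simp only [hreal] at hF
    refine hF.trans (le_of_eq (Tendsto.liminf_eq ?_))
    simp_rw [← Kernel.pow_succ_apply_eq_lintegral P _ x hA]
    exact (h' A).comp (tendsto_add_atTop_nat 1)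
  have : IsProbabilityMeasure (π.bind P) := ⟨by
    rw [Measure.bind_apply .univ P.aemeasurable]; simp⟩
  exact Measure.eq_of_le_of_isProbabilityMeasure (Measure.le_iff.2 hle)

end SetwiseLimit

/-! ### Geometric ergodicity from a drift condition and an atom -/

section Ergodicity

variable {S : Type*} [MeasurableSpace S] [DiscreteMeasurableSpace S]

theorem integrable_real_apply (Q : Kernel S S) [IsMarkovKernel Q] (A : Set S) (μ : Measure S)
    [IsProbabilityMeasure μ] : Integrable (fun y => (Q y).real A) μ :=
  Integrable.of_bound (C := 1)
    (Measurable.of_discrete : Measurable fun y => (Q y).real A).aestronglyMeasurable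
    (.of_forall fun y => by
      rw [Real.norm_eq_abs, abs_of_nonneg measureReal_nonneg]; exact measureReal_le_one)

/-- Geometric loss of memory, uniformly over events. The contraction acts on the `p`-step kernel; the
remaining `n % p` steps cost nothing since probabilities differ by at most `1`. -/
theorem exists_forall_abs_pow_sub_pow_le (P : Kernel S S) [IsMarkovKernel P] (V : S → ℝ≥0)
    {γ K : ℝ≥0} (hγ : γ < 1) (hdrift : ∀ x, ∫⁻ y, V y ∂(P x) ≤ γ * V x + K) (z : S) {p : ℕ}
    (hp : p ≠ 0)
    (hmin : ∀ R : ℝ, ∃ ε : ℝ, 0 < ε ∧ ∀ x, V x ≤ R → ε ≤ ((P ^ p) x).real {z}) :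
    ∃ β ρ c : ℝ, 0 ≤ β ∧ 0 < ρ ∧ ρ < 1 ∧ 0 ≤ c ∧ ∀ (n : ℕ) (A : Set S) (x y : S),
      |((P ^ n) x).real A - ((P ^ n) y).real A| ≤ c * ρ ^ n * (1 + β * (V x + V y)) := by
  have hm : ∀ n, IsMarkovKernel (P ^ n) := isMarkovKernel_pow P
  have hdrift' : ∀ x, ∫⁻ y, V y ∂((P ^ p) x) ≤ ↑(γ ^ p) * V x + ↑(p * K) := fun x => by
    have := lintegral_pow_le_of_drift P V hγ.le hdrift p x
    push_cast
    exact this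
  obtain ⟨β, α, hβ, hα0, hα1, hcontr⟩ :=
    exists_contraction_of_drift_of_atom (P ^ p) V (pow_lt_one₀ γ.2 hγ hp) hdrift' z hmin
  have hblock : ∀ (k m : ℕ) (A : Set S) (x y : S),
      |((P ^ (p * k + m)) x).real A - ((P ^ (p * k + m)) y).real A| ≤
        α ^ k * (1 + β * (V x + V y)) := by
    intro k m A
    induction k with
    | zero =>
      intro x y
      have hW : 0 ≤ β * ((V x : ℝ) + V y) := by positivity
      have h1 : |((P ^ (p * 0 + m)) x).real A - ((P ^ (p * 0 + m)) y).real A| ≤ 1 :=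
        abs_sub_le_of_nonneg_of_le measureReal_nonneg measureReal_le_one
          measureReal_nonneg measureReal_le_one
      linarith
    | succ k ih =>
      intro x y
      have e : p * (k + 1) + m = p + (p * k + m) := by ring
      rw [e, real_pow_add_apply P _ _ x .of_discrete, real_pow_add_apply P _ _ y .of_discrete,
        pow_succ']
      exact hcontr _ _ (by positivity) (fun _ => integrable_real_apply _ A _) ih x y
  have hp' : (p : ℝ) ≠ 0 := by exact_mod_cast hp
  have hρp : (α ^ (1 / p : ℝ)) ^ p = α := by
    rw [← Real.rpow_natCast, ← Real.rpow_mul hα0.le, one_div_mul_cancel hp', Real.rpow_one]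
  have hρ0 : 0 < α ^ (1 / p : ℝ) := Real.rpow_pos_of_pos hα0 _
  have hρ1 : α ^ (1 / p : ℝ) < 1 := Real.rpow_lt_one hα0.le hα1 (by positivity)
  refine ⟨β, α ^ (1 / p : ℝ), α⁻¹, hβ, hρ0, hρ1, (inv_pos.2 hα0).le, fun n A x y => ?_⟩
  have hpow : α ^ (n / p) ≤ α⁻¹ * (α ^ (1 / p : ℝ)) ^ n := by
    rw [← div_eq_inv_mul, le_div_iff₀ hα0, ← pow_succ]
    calc α ^ (n / p + 1) = (α ^ (1 / p : ℝ)) ^ (p * (n / p + 1)) := by rw [pow_mul, hρp]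
      _ ≤ _ := pow_le_pow_of_le_one hρ0.le hρ1.le
        (Nat.lt_mul_div_succ n (Nat.pos_of_ne_zero hp)).le
  have hb := hblock (n / p) (n % p) A x y
  rw [Nat.div_add_mod] at hb
  exact hb.trans (mul_le_mul_of_nonneg_right hpow (by positivity))

/-- Harris' theorem in the presence of an atom: the drift condition is on `P`, the lower bound at the
atom `z` on some positive power of `P`. -/
theorem isGeometricallyErgodic_of_drift_of_atom (P : Kernel S S) [IsMarkovKernel P] (V : S → ℝ≥0)
    {γ K : ℝ≥0} (hγ : γ < 1) (hdrift : ∀ x, ∫⁻ y, V y ∂(P x) ≤ γ * V x + K) (z : S) {p : ℕ}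
    (hp : p ≠ 0)
    (hmin : ∀ R : ℝ, ∃ ε : ℝ, 0 < ε ∧ ∀ x, V x ≤ R → ε ≤ ((P ^ p) x).real {z}) :
    IsGeometricallyErgodic P := by
  have hm : ∀ n, IsMarkovKernel (P ^ n) := isMarkovKernel_pow P
  obtain ⟨β, ρ, c, hβ, hρ0, hρ1, hc, hcontr⟩ :=
    exists_forall_abs_pow_sub_pow_le P V hγ hdrift z hp hmin
  -- Started from `x`, one extra initial step moves the law at time `n` by at most `D x * ρ ^ n`.
  obtain ⟨D, hD⟩ : ∃ D : S → ℝ, ∀ x, D x = c * (1 + β * (γ * V x + K + V x)) :=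
    ⟨_, fun _ => rfl⟩
  have hstep : ∀ (x : S) (A : Set S) (n : ℕ),
      dist (((P ^ n) x).real A) (((P ^ (n + 1)) x).real A) ≤ D x * ρ ^ n := by
    intro x A n
    obtain ⟨hi, hVx⟩ := integrable_and_integral_le_of_lintegral_le (c := γ * V x + K)
      (by exact_mod_cast hdrift x)
    push_cast at hVx
    have hdiff : ((P ^ (n + 1)) x).real A - ((P ^ n) x).real A =
        ∫ y, (((P ^ n) y).real A - ((P ^ n) x).real A) ∂(P x) := by
      rw [add_comm, real_pow_add_apply P 1 n x .of_discrete, pow_one,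
        integral_sub (integrable_real_apply _ A _) (integrable_const _)]
      simp
    rw [dist_comm, Real.dist_eq, hdiff]
    have hg : Integrable (fun y => c * ρ ^ n * (1 + β * ((V y : ℝ) + V x))) (P x) :=
      ((integrable_const _).add ((hi.add (integrable_const _)).const_mul β)).const_mul _
    have hle := norm_integral_le_of_norm_le
      (f := fun y => ((P ^ n) y).real A - ((P ^ n) x).real A) hg
      (.of_forall fun y => hcontr n A y x)
    rw [Real.norm_eq_abs] at hle
    refine hle.trans ?_
    have hVi : Integrable (fun y => (V y : ℝ) + V x) (P x) := hi.add (integrable_const _)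
    rw [integral_const_mul, integral_add (integrable_const _) (hVi.const_mul β),
      integral_const_mul, integral_add hi (integrable_const _)]
    simp only [integral_const, probReal_univ, smul_eq_mul, one_mul]
    rw [hD, mul_right_comm c]
    gcongr
  have hlim : ∀ (x : S) (A : Set S), ∃ l, Tendsto (fun n => ((P ^ n) x).real A) atTop (𝓝 l) :=
    fun x A => cauchySeq_tendsto_of_complete (cauchySeq_of_le_geometric ρ _ hρ1 (hstep x A))
  have hρn : Tendsto (fun n => ρ ^ n) atTop (𝓝 0) :=
    tendsto_pow_atTop_nhds_zero_of_lt_one hρ0.le hρ1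
  choose l hl using fun A => hlim z A
  have hlx : ∀ x A, Tendsto (fun n => ((P ^ n) x).real A) atTop (𝓝 (l A)) := by
    intro x A
    have h0 : Tendsto (fun n => ((P ^ n) x).real A - ((P ^ n) z).real A) atTop (𝓝 0) := by
      refine squeeze_zero_norm (fun n => hcontr n A x z) ?_
      simpa using (hρn.const_mul c).mul_const (1 + β * ((V x : ℝ) + V z))
    simpa using h0.add (hl A)
  have hrate : ∀ x n A, |((P ^ n) x).real A - l A| ≤ D x / (1 - ρ) * ρ ^ n := fun x n A => by
    have := dist_le_of_le_geometric_of_tendsto ρ (D x) hρ1 (hstep x A) (hlx x A) n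
    rwa [Real.dist_eq, mul_div_right_comm] at this
  obtain ⟨π, hπ, hπl⟩ := exists_isProbabilityMeasure_of_uniform_setwise_limit
    (fun n => (P ^ n) z) l (fun n => D z / (1 - ρ) * ρ ^ n) (by simpa using hρn.const_mul _)
    fun n A _ => hrate z n A
  refine ⟨π, hπ, invariant_of_tendsto_pow P π z fun A => ?_, ρ, hρ0, hρ1,
    fun x => ⟨D x / (1 - ρ), fun n => ?_⟩⟩
  · rw [hπl A .of_discrete]; exact hl A
  · have : Nonempty {A : Set S // MeasurableSet A} := ⟨⟨∅, .empty⟩⟩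
    refine ciSup_le fun A => ?_
    rw [hπl _ A.2]
    exact hrate x n A

end Ergodicity

/-! ### Poisson mean and the Hawkes kernel -/

section HawkesProcess

theorem lintegral_natCast_poissonMeasure (r : ℝ≥0) : ∫⁻ n, (n : ℝ≥0∞) ∂(poissonMeasure r) = r := by
  have h1 : ∑' n, poissonMeasure r {n} = 1 := by
    have := lintegral_countable' (μ := poissonMeasure r) (fun _ => 1)
    simpa using this.symm
  rw [lintegral_countable', tsum_eq_zero_add' ENNReal.summable]
  have h2 : ∀ n : ℕ, ((n + 1 : ℕ) : ℝ≥0∞) * poissonMeasure r {n + 1} = r * poissonMeasure r {n} := by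
    intro n
    rw [poissonMeasure_singleton, poissonMeasure_singleton, ← ENNReal.ofReal_natCast,
      ← ENNReal.ofReal_coe_nnreal, ← ENNReal.ofReal_mul (by positivity),
      ← ENNReal.ofReal_mul (by positivity), Nat.factorial_succ]
    congr 1
    have : (n.factorial : ℝ) ≠ 0 := by positivity
    push_cast
    field_simp
    ring
  simp_rw [h2]
  rw [ENNReal.tsum_mul_left, h1]
  simp

variable {p : ℕ} (a : Fin p → ℝ) (lam : ℝ)

theorem hawkesKernel_apply (x : Fin p → ℕ) : hawkesKernel a lam x =
    (poissonMeasure (hawkesIntensity a lam x)).map (hawkesShift x) := rfl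

instance isMarkovKernel_hawkesKernel : IsMarkovKernel (hawkesKernel a lam) :=
  ⟨fun x => by
    rw [hawkesKernel_apply]
    exact Measure.isProbabilityMeasure_map Measurable.of_discrete.aemeasurable⟩

theorem exp_neg_le_hawkesKernel_shift_zero (x : Fin p → ℕ) :
    Real.exp (-hawkesIntensity a lam x) ≤ (hawkesKernel a lam x).real {hawkesShift x 0} := by
  rw [hawkesKernel_apply, map_measureReal_apply .of_discrete .of_discrete]
  calc Real.exp (-hawkesIntensity a lam x)
      = (poissonMeasure (hawkesIntensity a lam x)).real {0} := by
        simp [poissonMeasure_real_singleton]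
    _ ≤ _ := measureReal_mono (by simp)

theorem iterate_hawkesShift_zero (x : Fin p → ℕ) :
    (fun y => hawkesShift y 0)^[p] x = 0 := by
  have h : ∀ (k : ℕ) (i : Fin p), (i : ℕ) < k → ((fun y => hawkesShift y 0)^[k] x) i = 0 := by
    intro k
    induction k with
    | zero => intro i hi; omega
    | succ k ih =>
      intro i hi
      rw [Function.iterate_succ_apply']
      obtain _ | ⟨q⟩ := p
      · exact i.elim0
      · cases i using Fin.cases with
        | zero => rfl
        | succ j =>
          have : hawkesShift ((fun y => hawkesShift y 0)^[k] x) 0 j.succ =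
            ((fun y => hawkesShift y 0)^[k] x) j.castSucc := rfl
          rw [this]
          exact ih _ (by simp at hi ⊢; omega)
  funext i
  exact h p i i.2

end HawkesProcess

/-! ### Drift and atom for the Hawkes kernel -/

section Drift

/-- Weights of a linear Lyapunov function for the shift chain: `w i` is the tail sum of `b j + δ` over
`j ≥ i`, where `δ` is normalised so that `w 0 = 1`. -/
theorem exists_weights {p : ℕ} (hp : p ≠ 0) (b : Fin p → ℝ≥0) (hb : ∑ i, b i < 1) :
    ∃ (w : ℕ → ℝ≥0) (γ : ℝ≥0), γ < 1 ∧ w 0 = 1 ∧ w p = 0 ∧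
      ∀ i : Fin p, b i + w (i + 1) ≤ γ * w i := by
  have hp' : (p : ℝ≥0) ≠ 0 := by exact_mod_cast hp
  -- `δ` is the slack `1 - ∑ b` shared equally between the coordinates.
  obtain ⟨δ, hδ⟩ : ∃ δ : ℝ≥0, δ = (1 - ∑ i, b i) / p := ⟨_, rfl⟩
  have hδ0 : 0 < δ := by rw [hδ]; exact div_pos (tsub_pos_of_lt hb) (pos_iff_ne_zero.2 hp')
  have hpδ : ∑ i, (b i + δ) = 1 := by
    rw [Finset.sum_add_distrib, hδ]
    simp only [Finset.sum_const, Finset.card_univ, Fintype.card_fin, nsmul_eq_mul]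
    rw [mul_div_cancel₀ _ hp', add_tsub_cancel_of_le hb.le]
  let w : ℕ → ℝ≥0 := fun k =>
    ∑ j ∈ Finset.univ.filter fun j : Fin p => k ≤ (j : ℕ), (b j + δ)
  have hw1 : ∀ k, w k ≤ 1 := fun k =>
    hpδ ▸ Finset.sum_le_sum_of_subset (Finset.filter_subset _ _)
  have hwi : ∀ i : Fin p, w i = b i + δ + w (i + 1) := by
    intro i
    have : (Finset.univ.filter fun j : Fin p => (i : ℕ) ≤ j) =
        insert i (Finset.univ.filter fun j : Fin p => (i : ℕ) + 1 ≤ j) := by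
      ext j
      simp [Fin.ext_iff]
      omega
    simp only [w]
    rw [this, Finset.sum_insert (by simp)]
  have hδ1 : δ ≤ 1 := by
    have h := hwi ⟨0, Nat.pos_of_ne_zero hp⟩
    refine le_trans ?_ (hw1 ((⟨0, Nat.pos_of_ne_zero hp⟩ : Fin p) : ℕ))
    rw [h, add_right_comm]
    exact le_add_self
  refine ⟨w, 1 - δ, tsub_lt_self one_pos hδ0, by simpa [w] using hpδ, ?_, fun i => ?_⟩
  · simp only [w]
    rw [Finset.filter_false_of_mem fun j _ => by omega, Finset.sum_empty]
  · have h1 : δ * w i ≤ δ := mul_le_of_le_one_right' (hw1 i)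
    rw [tsub_mul, one_mul]
    refine le_tsub_of_add_le_right ?_
    calc b i + w (i + 1) + δ * w i ≤ b i + w (i + 1) + δ := by gcongr
      _ = w i := by rw [hwi i]; ring

variable {p : ℕ} {a : Fin p → ℝ} {lam : ℝ} {w : ℕ → ℝ≥0} {γ : ℝ≥0}

theorem hawkesIntensity_le (a : Fin p → ℝ) (lam : ℝ) (x : Fin p → ℕ) :
    hawkesIntensity a lam x ≤ ∑ i, (a i).toNNReal * x i + lam.toNNReal := by
  rw [hawkesIntensity, Real.toNNReal_le_iff_le_coe]
  push_cast
  refine add_le_add (Finset.sum_le_sum fun i _ => ?_) (Real.le_coe_toNNReal _)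
  exact mul_le_mul_of_nonneg_right (Real.le_coe_toNNReal _) (Nat.cast_nonneg _)

/-- The coordinate dropped by the shift has next weight `w p = 0`, so it may be kept in the sum. -/
theorem sum_weight_hawkesShift (h0 : w 0 = 1) (hwp : w p = 0) (x : Fin p → ℕ) (l : ℕ) :
    ∑ i : Fin p, w i * hawkesShift x l i = l + ∑ i : Fin p, w (i + 1) * x i := by
  have h1 := Fin.sum_univ_succ fun i : Fin (p + 1) =>
    w i * ((Fin.cons l x : Fin (p + 1) → ℕ) i : ℝ≥0)
  rw [Fin.sum_univ_castSucc] at h1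
  simpa [h0, hwp, hawkesShift] using h1

theorem lintegral_weight_hawkesKernel_le (h0 : w 0 = 1) (hwp : w p = 0)
    (hw : ∀ i : Fin p, (a i).toNNReal + w (i + 1) ≤ γ * w i) (x : Fin p → ℕ) :
    ∫⁻ y, ↑(∑ i : Fin p, w i * y i) ∂(hawkesKernel a lam x) ≤
      γ * ↑(∑ i : Fin p, w i * x i) + lam.toNNReal := by
  rw [hawkesKernel_apply, lintegral_map .of_discrete .of_discrete]
  simp_rw [sum_weight_hawkesShift h0 hwp]
  simp only [ENNReal.coe_add, ENNReal.coe_natCast]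
  rw [lintegral_add_right _ measurable_const, lintegral_natCast_poissonMeasure, lintegral_const,
    measure_univ, mul_one]
  norm_cast
  calc hawkesIntensity a lam x + ∑ i : Fin p, w (i + 1) * x i
      ≤ (∑ i, (a i).toNNReal * x i + lam.toNNReal) + ∑ i : Fin p, w (i + 1) * x i :=
        add_le_add_left (hawkesIntensity_le a lam x) _
    _ = ∑ i : Fin p, ((a i).toNNReal + w (i + 1)) * x i + lam.toNNReal := by
        simp_rw [add_mul, Finset.sum_add_distrib]; ring
    _ ≤ ∑ i : Fin p, (γ * w i) * x i + lam.toNNReal := by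
        gcongr with i; exact hw i
    _ = _ := by simp_rw [mul_assoc, Finset.mul_sum]

/-- From a state with `V x ≤ R`, the chain draws `n` zeros in a row with probability at least
`exp (-(R + lam₊)) ^ n`. -/
theorem exp_neg_mul_le_hawkesKernel_pow (hγ : γ ≤ 1) (h0 : w 0 = 1) (hwp : w p = 0)
    (hw : ∀ i : Fin p, (a i).toNNReal + w (i + 1) ≤ γ * w i) (R : ℝ) (n : ℕ) (x : Fin p → ℕ)
    (hx : ((∑ i : Fin p, w i * x i : ℝ≥0) : ℝ) ≤ R) :
    Real.exp (-(R + lam.toNNReal)) ^ n ≤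
      ((hawkesKernel a lam ^ n) x).real {(fun y => hawkesShift y 0)^[n] x} := by
  have hw' : ∀ i : Fin p, (a i).toNNReal + w (i + 1) ≤ w i := fun i =>
    (hw i).trans (mul_le_of_le_one_left' hγ)
  induction n generalizing x with
  | zero =>
    rw [pow_zero, pow_zero]
    change 1 ≤ ((Kernel.id : Kernel (Fin p → ℕ) (Fin p → ℕ)) x).real _
    rw [Kernel.id_apply, Measure.real, Function.iterate_zero_apply,
      Measure.dirac_apply_of_mem (Set.mem_singleton x), ENNReal.toReal_one]
  | succ n ih =>
    have hm := isMarkovKernel_pow (hawkesKernel a lam) n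
    set y := hawkesShift x 0 with hy
    have hVy : ((∑ i : Fin p, w i * y i : ℝ≥0) : ℝ) ≤ R := by
      refine le_trans ?_ hx
      rw [NNReal.coe_le_coe, hy, sum_weight_hawkesShift h0 hwp, Nat.cast_zero, zero_add]
      gcongr with i
      exact le_add_self.trans (hw' i)
    have hs : (hawkesIntensity a lam x : ℝ) ≤ R + lam.toNNReal := by
      refine le_trans ?_ (add_le_add_left hx _)
      rw [← NNReal.coe_add, NNReal.coe_le_coe]
      refine (hawkesIntensity_le a lam x).trans ?_
      gcongr with i
      exact le_self_add.trans (hw' i)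
    have h1 : Real.exp (-(R + lam.toNNReal)) ≤ (hawkesKernel a lam x).real {y} :=
      (Real.exp_le_exp.2 (neg_le_neg hs)).trans (exp_neg_le_hawkesKernel_shift_zero a lam x)
    rw [Function.iterate_succ_apply, add_comm n 1, real_pow_add_apply _ _ _ _ .of_discrete,
      pow_one, pow_add, pow_one]
    set f : (Fin p → ℕ) → ℝ := fun u => ((hawkesKernel a lam ^ n) u).real
      {(fun y => hawkesShift y 0)^[n] y} with hf
    calc Real.exp (-(R + lam.toNNReal)) * Real.exp (-(R + lam.toNNReal)) ^ n
        ≤ (hawkesKernel a lam x).real {y} * f y :=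
          mul_le_mul h1 (ih y hVy) (by positivity) measureReal_nonneg
      _ = ∫ u in {y}, f u ∂(hawkesKernel a lam x) := by
          rw [integral_singleton, smul_eq_mul]
      _ ≤ ∫ u, f u ∂(hawkesKernel a lam x) :=
          setIntegral_le_integral (integrable_real_apply _ _ _) (.of_forall fun _ => measureReal_nonneg)

theorem isGeometricallyErgodic_hawkesKernel (hp : p ≠ 0) (a : Fin p → ℝ) (lam : ℝ)
    (ha : ∑ i, (a i).toNNReal < 1) : IsGeometricallyErgodic (hawkesKernel a lam) := by
  obtain ⟨w, γ, hγ, h0, hwp, hw⟩ := exists_weights hp (fun i => (a i).toNNReal) ha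
  refine isGeometricallyErgodic_of_drift_of_atom (hawkesKernel a lam)
    (fun x => ∑ i : Fin p, w i * x i) hγ (lintegral_weight_hawkesKernel_le h0 hwp hw) 0 hp
    fun R => ⟨Real.exp (-(R + lam.toNNReal)) ^ p, by positivity, fun x hx => ?_⟩
  have := exp_neg_mul_le_hawkesKernel_pow (lam := lam) hγ.le h0 hwp hw R p x hx
  rwa [iterate_hawkesShift_zero] at this

end Drift

/-! ### The Markov property of the memory vector -/

section MarkovProperty

theorem hawkesKernel_singleton_hawkesShift {q : ℕ} (a : Fin (q + 1) → ℝ) (lam : ℝ)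
    (x : Fin (q + 1) → ℕ) (l : ℕ) :
    hawkesKernel a lam x {hawkesShift x l} = poissonMeasure (hawkesIntensity a lam x) {l} := by
  rw [hawkesKernel_apply, Measure.map_apply .of_discrete .of_discrete]
  congr 1
  ext m
  exact ⟨fun h => congrFun (Set.mem_singleton_iff.1 h) 0,
    fun h => by rw [Set.mem_singleton_iff.1 h]; rfl⟩

theorem hawkesKernel_singleton_eq_zero {p : ℕ} (a : Fin p → ℝ) (lam : ℝ) {x y : Fin p → ℕ}
    (h : ∀ l, hawkesShift x l ≠ y) : hawkesKernel a lam x {y} = 0 := by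
  rw [hawkesKernel_apply, Measure.map_apply .of_discrete .of_discrete]
  convert measure_empty (μ := poissonMeasure (hawkesIntensity a lam x))
  ext l
  simpa using h l

/-- The scalar history read off a sequence `y` of memory vectors: newest entries at nonnegative
times, entries of `y 0` at negative times. Only the times `k ≥ -q` carry meaning. -/
def scalarHistory {q : ℕ} (y : ℕ → Fin (q + 1) → ℕ) (k : ℤ) : ℕ :=
  if 0 ≤ k then y k.toNat 0 else y 0 (Fin.ofNat (q + 1) (-k).toNat)

/-- The memory vectors up to time `n` determine all values of the process from time `1 - p` to `n`. -/
theorem forall_memoryVector_eq_imp {Ω : Type*} {q : ℕ} {Xt : ℤ → Ω → ℕ} {y : ℕ → Fin (q + 1) → ℕ}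
    {n : ℕ} {ω : Ω} (h : ∀ k ≤ n, memoryVector (q + 1) Xt k ω = y k) (k : ℤ)
    (hk : 1 - ((q + 1 : ℕ) : ℤ) ≤ k) (hkn : k ≤ n) : Xt k ω = scalarHistory y k := by
  rw [scalarHistory]
  split_ifs with h0
  · rw [← h k.toNat (by omega)]
    simp [memoryVector, h0]
  · rw [← h 0 (Nat.zero_le _)]
    have : (((Fin.ofNat (q + 1) (-k).toNat : Fin (q + 1)) : ℕ) : ℤ) = -k := by
      rw [Fin.val_ofNat, Nat.mod_eq_of_lt (by omega)]
      omega
    rw [memoryVector, this, Nat.cast_zero, zero_sub, neg_neg]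

theorem setOf_memoryVector_eq {Ω : Type*} {q : ℕ} (Xt : ℤ → Ω → ℕ) {y : ℕ → Fin (q + 1) → ℕ}
    {n : ℕ} (hy : ∀ k ≤ n, ∀ i : Fin (q + 1), y k i = scalarHistory y ((k : ℤ) - (i : ℤ))) :
    {ω | ∀ k ≤ n, memoryVector (q + 1) Xt k ω = y k} =
      {ω | ∀ k : ℤ, 1 - ((q + 1 : ℕ) : ℤ) ≤ k → k ≤ (n : ℤ) → Xt k ω = scalarHistory y k} := by
  ext ω
  refine ⟨fun h => forall_memoryVector_eq_imp h, fun h k hk => funext fun i => ?_⟩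
  rw [hy k hk i]
  exact h _ (by have := i.2; omega) (by omega)

theorem setOf_memoryVector_eq_empty {Ω : Type*} {q : ℕ} (Xt : ℤ → Ω → ℕ)
    {y : ℕ → Fin (q + 1) → ℕ} {n : ℕ}
    (hy : ¬ ∀ k ≤ n, ∀ i : Fin (q + 1), y k i = scalarHistory y ((k : ℤ) - (i : ℤ))) :
    {ω | ∀ k ≤ n, memoryVector (q + 1) Xt k ω = y k} = ∅ := by
  refine Set.eq_empty_of_forall_notMem fun ω h => hy fun k hk i => ?_
  rw [← h k hk]
  exact forall_memoryVector_eq_imp h _ (by have := i.2; omega) (by omega)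

theorem hawkesShift_eq_iff {q : ℕ} {x y : Fin (q + 1) → ℕ} {l : ℕ} :
    hawkesShift x l = y ↔ l = y 0 ∧ ∀ i : Fin q, x i.castSucc = y i.succ := by
  rw [funext_iff, Fin.forall_fin_succ]
  rfl

theorem IsHawkesProcess.isMarkovChain_memoryVector {Ω : Type*} [MeasurableSpace Ω] {q : ℕ}
    {a : Fin (q + 1) → ℝ} {lam : ℝ} {μ : Measure Ω} {Xt : ℤ → Ω → ℕ}
    (h : IsHawkesProcess a lam μ Xt) :
    IsMarkovChain (hawkesKernel a lam) μ (memoryVector (q + 1) Xt) where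
  measurable n := measurable_pi_lambda _ fun i => h.measurable _
  markov n y := by
    by_cases hy : ∀ k ≤ n, ∀ i : Fin (q + 1), y k i = scalarHistory y ((k : ℤ) - (i : ℤ))
    swap
    · rw [setOf_memoryVector_eq_empty Xt hy,
        setOf_memoryVector_eq_empty Xt fun h' => hy fun k hk => h' k (by omega)]
      simp
    have hlast : scalarHistory y ((n : ℤ) + 1) = y (n + 1) 0 := by
      rw [scalarHistory, if_pos (by omega)]
      rfl
    have hprev : ∀ i : Fin q, y n i.castSucc =
        scalarHistory y (((n + 1 : ℕ) : ℤ) - (i.succ : ℕ)) := fun i => by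
      rw [hy n le_rfl]
      congr 1
      simp
    by_cases hs : hawkesShift (y n) (y (n + 1) 0) = y (n + 1)
    · have hy' : ∀ k ≤ n + 1, ∀ i : Fin (q + 1),
          y k i = scalarHistory y ((k : ℤ) - (i : ℤ)) := by
        intro k hk i
        rcases Nat.lt_or_ge n k with hk' | hk'
        · obtain rfl : k = n + 1 := by omega
          cases i using Fin.cases with
          | zero => simpa using hlast.symm
          | succ i => rw [← (hawkesShift_eq_iff.1 hs).2 i]; exact hprev i
        · exact hy k hk' i
      rw [setOf_memoryVector_eq Xt hy', setOf_memoryVector_eq Xt hy]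
      have hc := h.cond_poisson n (scalarHistory y)
      rw [show (fun i : Fin (q + 1) => scalarHistory y ((n : ℤ) - (i : ℤ))) = y n from
        funext fun i => (hy n le_rfl i).symm, hlast, ← hawkesKernel_singleton_hawkesShift, hs] at hc
      exact_mod_cast hc
    · rw [setOf_memoryVector_eq_empty Xt fun h' => hs (hawkesShift_eq_iff.2 ⟨rfl, fun i => by
        rw [hprev, h' (n + 1) le_rfl]⟩),
        hawkesKernel_singleton_eq_zero a lam fun l hl => hs (by
          rwa [← (hawkesShift_eq_iff.1 hl).1])]
      simp

end MarkovProperty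

theorem theorem1 (p : ℕ) (hp : 1 ≤ p) (a : Fin p → ℝ) (lam : ℝ) (hlam : 0 < lam)
    (ha : ∑ i, max 0 (a i) < 1) :
    (∀ {Ω : Type*} [MeasurableSpace Ω] (μ : Measure Ω) [IsProbabilityMeasure μ]
        (Xt : ℤ → Ω → ℕ), IsHawkesProcess a lam μ Xt →
        IsMarkovChain (hawkesKernel a lam) μ (memoryVector p Xt)) ∧
      IsGeometricallyErgodic (hawkesKernel a lam) := by
  refine ⟨fun μ _ Xt h => ?_, isGeometricallyErgodic_hawkesKernel (by omega) a lam ?_⟩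
  · obtain ⟨q, rfl⟩ : ∃ q, p = q + 1 := ⟨p - 1, by omega⟩
    exact h.isMarkovChain_memoryVector
  · rw [← NNReal.coe_lt_coe]
    push_cast
    simpa [Real.coe_toNNReal', max_comm] using ha
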